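/- Let $\mathbb{U}=\{z\in\mathbb{C}:|z|<1\}$, and let $H^2$ be the Hardy space of $\mathbb{U}$: the Hilbert space of all functions $f(z)=\sum_{n\ge 0}a_nz^n$ on $\mathbb{U}$ with $\|f\|^2=\sum_{n\ge 0}|a_n|^2<\infty$. For a bounded analytic function $\varphi$ on $\mathbb{U}$ let $T_\varphi$ be the analytic Toeplitz operator $T_\varphi f=\varphi f$ on $H^2$, so that $T_z$ is multiplication by the coordinate function $z$. For a bounded linear operator $A$ on $H^2$ let $\{A\}'$ denote its commutant, the set of all bounded linear operators on $H^2$ that commute with $A$. We say that $\varphi$ singly covers a set $W\subset\mathbb{C}$ if there is a set $V\subset\mathbb{U}$ such that $\varphi$ maps $V$ one-to-one onto $W$ and $\{z\in\mathbb{U}:\varphi(z)\in W\}=V$. Corollary (Deddens–Wong). Let $\varphi$ be a bounded analytic function on $\mathbb{U}$ that singly covers some nonvoid open set $W\subset\varphi(\mathbb{U})$. Then $$\{T_\varphi\}'=\{T_z\}',$$ and every operator in $\{T_\varphi\}'$ is an analytic Toeplitz operator: if $X\in\{T_\varphi\}'$, then $X=T_h$ for some bounded analytic function $h$ on $\mathbb{U}$.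 -/

import Mathlib

noncomputable section

open Complex Metric Set
open scoped Complex.UnitDisc lp

/-! ### The Hardy space `H²` of the open unit disc -/

/-- The functions on the open unit disc `𝔻` that are sums of a power series
`∑ aₙ zⁿ` with square-summable coefficients. -/
def hardySubmodule : Submodule ℂ (𝔻 → ℂ) where
  carrier := {f | ∃ a : ℕ → ℂ, (Summable fun n => ‖a n‖ ^ 2) ∧
    ∀ z : 𝔻, HasSum (fun n => a n * (z : ℂ) ^ n) (f z)}
  zero_mem' := ⟨0, by simp, fun z => by simp⟩
  add_mem' := by
    rintro f g ⟨a, ha, hf⟩ ⟨b, hb, hg⟩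
    refine ⟨a + b, ?_, fun z => ?_⟩
    · refine Summable.of_nonneg_of_le (fun n => by positivity) (fun n => ?_)
        ((ha.mul_left 2).add (hb.mul_left 2))
      have h := norm_add_le (a n) (b n)
      have h0 := norm_nonneg (a n + b n)
      simp only [Pi.add_apply]
      nlinarith [sq_nonneg (‖a n‖ - ‖b n‖)]
    · simpa [add_mul] using (hf z).add (hg z)
  smul_mem' := by
    rintro c f ⟨a, ha, hf⟩
    refine ⟨c • a, ?_, fun z => ?_⟩
    · simpa [mul_pow] using ha.mul_left (‖c‖ ^ 2)
    · simpa [mul_assoc] using (hf z).mul_left c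

/-- The Hardy space `H²` (its norm, defined below, is the `ℓ²` norm of the power series
coefficients, not a norm inherited from the space of all functions). -/
def HardySpace : Type := hardySubmodule

namespace HardySpace

instance : AddCommGroup HardySpace := inferInstanceAs (AddCommGroup hardySubmodule)

instance : Module ℂ HardySpace := inferInstanceAs (Module ℂ hardySubmodule)

instance : CoeFun HardySpace fun _ => 𝔻 → ℂ := ⟨Subtype.val⟩

theorem ext {f g : HardySpace} (h : ∀ z : 𝔻, f z = g z) : f = g := Subtype.ext (funext h)

@[simp] theorem add_apply (f g : HardySpace) (z : 𝔻) : (f + g) z = f z + g z := rfl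

@[simp] theorem smul_apply (c : ℂ) (f : HardySpace) (z : 𝔻) : (c • f) z = c * f z := rfl

theorem summable_sq (a : ℓ²(ℕ, ℂ)) : Summable fun n => ‖a n‖ ^ 2 := by
  have h := (lp.memℓp a).summable (by norm_num)
  simpa using h

theorem norm_sq_eq (a : ℓ²(ℕ, ℂ)) : ‖a‖ ^ 2 = ∑' n, ‖a n‖ ^ 2 := by
  have h := lp.norm_rpow_eq_tsum (p := 2) (by norm_num) a
  simpa using h

theorem hasFPowerSeriesOnBall {a : ℕ → ℂ} {C : ℝ} (ha : ∀ n, ‖a n‖ ≤ C) :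
    HasFPowerSeriesOnBall (fun z : ℂ => ∑' n, a n * z ^ n)
      (FormalMultilinearSeries.ofScalars ℂ a) 0 1 := by
  refine ⟨?_, one_pos, ?_⟩
  · have h := (FormalMultilinearSeries.ofScalars ℂ a).le_radius_of_bound (r := 1) C (fun n => by
      simpa using ha n)
    simpa using h
  · intro y hy
    have hy' : ‖y‖ < 1 := by
      rw [mem_eball_zero_iff, enorm_eq_nnnorm] at hy
      exact_mod_cast hy
    have hs : Summable fun n => a n * y ^ n := by
      refine Summable.of_norm_bounded (g := fun n => C * ‖y‖ ^ n)
        ((summable_geometric_of_lt_one (norm_nonneg y) hy').mul_left C) (fun n => ?_)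
      rw [norm_mul, norm_pow]
      exact mul_le_mul_of_nonneg_right (ha n) (by positivity)
    simpa [FormalMultilinearSeries.ofScalars_apply_eq, mul_comm] using hs.hasSum

theorem norm_apply_le (a : ℓ²(ℕ, ℂ)) (n : ℕ) : ‖a n‖ ≤ ‖a‖ :=
  lp.norm_apply_le_norm (by norm_num) a n

theorem hasSum_pow (a : ℓ²(ℕ, ℂ)) (z : 𝔻) :
    HasSum (fun n => a n * (z : ℂ) ^ n) (∑' n, a n * (z : ℂ) ^ n) := by
  have h := (hasFPowerSeriesOnBall (norm_apply_le a)).hasSum (y := (z : ℂ))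
    (by
      rw [mem_eball_zero_iff, enorm_eq_nnnorm]
      exact_mod_cast z.norm_lt_one)
  simpa [FormalMultilinearSeries.ofScalars_apply_eq, mul_comm] using h

/-- The function `z ↦ ∑ aₙ zⁿ` attached to a square-summable sequence `a`. -/
def ofCoeff : ℓ²(ℕ, ℂ) →ₗ[ℂ] HardySpace where
  toFun a := ⟨fun z => ∑' n, a n * (z : ℂ) ^ n, a, summable_sq a, hasSum_pow a⟩
  map_add' a b := ext fun z => by
    refine (hasSum_pow (a + b) z).unique ?_
    have h := (hasSum_pow a z).add (hasSum_pow b z)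
    refine (h.congr_fun fun n => ?_ :)
    simp [add_mul]
  map_smul' c a := ext fun z => by
    refine (hasSum_pow (c • a) z).unique ?_
    have h := (hasSum_pow a z).mul_left c
    refine (h.congr_fun fun n => ?_ :)
    simp [mul_assoc]

theorem ofCoeff_apply (a : ℓ²(ℕ, ℂ)) (z : 𝔻) : ofCoeff a z = ∑' n, a n * (z : ℂ) ^ n := rfl

theorem ofCoeff_bijective : Function.Bijective ofCoeff := by
  constructor
  · intro a b hab
    have h1 := (hasFPowerSeriesOnBall (norm_apply_le a)).hasFPowerSeriesAt
    have h2 := (hasFPowerSeriesOnBall (norm_apply_le b)).hasFPowerSeriesAt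
    have h3 : (fun z : ℂ => ∑' n, a n * z ^ n) =ᶠ[nhds 0] fun z : ℂ => ∑' n, b n * z ^ n := by
      filter_upwards [ball_mem_nhds (0 : ℂ) one_pos] with z hz
      have hz' : ‖z‖ < 1 := by simpa using hz
      exact congrFun (congrArg Subtype.val hab) (UnitDisc.mk z hz')
    have h4 := h1.eq_formalMultilinearSeries (h2.congr h3.symm)
    exact lp.ext (FormalMultilinearSeries.ofScalars_series_injective ℂ ℂ h4)
  · rintro ⟨f, a, ha, hf⟩
    refine ⟨⟨a, memℓp_gen (by simpa using ha)⟩, ext fun z => ?_⟩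
    exact (hf z).tsum_eq

/-- The sequence of power series coefficients of a function in `H²`. -/
def coeff : HardySpace ≃ₗ[ℂ] ℓ²(ℕ, ℂ) := (LinearEquiv.ofBijective ofCoeff ofCoeff_bijective).symm

theorem hasSum_coeff (f : HardySpace) (z : 𝔻) :
    HasSum (fun n => coeff f n * (z : ℂ) ^ n) (f z) := by
  have h : ofCoeff (coeff f) = f :=
    (LinearEquiv.ofBijective ofCoeff ofCoeff_bijective).apply_symm_apply f
  have h2 := hasSum_pow (coeff f) z
  rwa [← ofCoeff_apply, h] at h2

/-- The norm of `H²` is the `ℓ²` norm of the coefficients. -/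
instance : NormedAddCommGroup HardySpace :=
  NormedAddCommGroup.induced HardySpace ℓ²(ℕ, ℂ) coeff coeff.injective

theorem norm_def (f : HardySpace) : ‖f‖ = ‖coeff f‖ := rfl

/-- The inner product of `H²` is `⟪f, g⟫ = ∑ conj (aₙ) bₙ` where `aₙ`, `bₙ` are the coefficients of
`f` and `g`. -/
instance : InnerProductSpace ℂ HardySpace where
  norm_smul_le c f := by rw [norm_def, norm_def, map_smul, norm_smul]
  inner f g := inner ℂ (coeff f) (coeff g)
  norm_sq_eq_re_inner f := by rw [norm_def]; exact norm_sq_eq_re_inner (coeff f)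
  conj_inner_symm f g := inner_conj_symm (coeff f) (coeff g)
  add_left f g h := by rw [map_add, inner_add_left]
  smul_left f g c := by rw [map_smul, inner_smul_left]

theorem isometry_coeff : Isometry coeff :=
  AddMonoidHomClass.isometry_of_norm coeff fun _ => rfl

instance : CompleteSpace HardySpace :=
  ((IsometryEquiv.mk coeff.toEquiv isometry_coeff).completeSpace)

end HardySpace

/-! ### Bounded analytic functions and analytic Toeplitz operators -/

/-- `φ` is a bounded analytic function on the open unit disc; its values elsewhere are irrelevant. -/
structure BoundedAnalytic (φ : ℂ → ℂ) : Prop where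
  differentiableOn : DifferentiableOn ℂ φ (ball 0 1)
  bounded : ∃ C : ℝ, ∀ z ∈ ball (0 : ℂ) 1, ‖φ z‖ ≤ C

theorem boundedAnalytic_id : BoundedAnalytic fun z => z :=
  ⟨differentiableOn_id, 1, fun z hz => by simpa using (mem_ball_zero_iff.1 hz).le⟩

namespace HardySpace

open MeasureTheory AddCircle in
theorem norm_sq_toLp_tsum {b : ℕ → ℂ} (hb : Summable fun n => ‖b n‖) :
    HasSum (fun n => ‖b n‖ ^ 2)
      (‖ContinuousMap.toLp (E := ℂ) 2 (haarAddCircle (T := 1)) ℂ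
        (∑' n, b n • fourier (T := 1) n)‖ ^ 2) := by
  have hs : Summable fun n : ℕ => b n • fourier (T := 1) n :=
    Summable.of_norm (by simpa [norm_smul, fourier_norm] using hb)
  have h1 := hs.hasSum.mapL (ContinuousMap.toLp (E := ℂ) 2 (haarAddCircle (T := 1)) ℂ)
  rw [hasSum_iff_tendsto_nat_of_nonneg (fun n => by positivity)]
  refine (h1.tendsto_sum_nat.norm.pow 2).congr fun N => ?_
  have ho : Orthonormal ℂ fun n : ℕ => fourierLp (T := 1) 2 n :=
    (orthonormal_fourier (T := 1)).comp _ Nat.cast_injective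
  have h2 := ho.inner_sum b b (Finset.range N)
  rw [inner_self_eq_norm_sq_to_K] at h2
  simp only [map_smul]
  have h3 : ∀ n, (starRingEnd ℂ) (b n) * b n = ((‖b n‖ ^ 2 : ℝ) : ℂ) := fun n => by
    rw [Complex.conj_mul']; push_cast; rfl
  simp only [h3] at h2
  have h4 : ‖∑ i ∈ Finset.range N, b i • fourierLp (T := 1) 2 (i : ℤ)‖ ^ 2 =
      ∑ i ∈ Finset.range N, ‖b i‖ ^ 2 := by
    apply Complex.ofReal_injective
    rw [Complex.ofReal_sum]
    refine Eq.trans ?_ h2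
    exact Complex.ofReal_pow _ _
  exact h4

open MeasureTheory AddCircle in
theorem tsum_sq_le {b c : ℕ → ℂ} (hb : Summable fun n => ‖b n‖) (hc : Summable fun n => ‖c n‖)
    {C : ℝ} (h : ∀ w : ℂ, ‖w‖ = 1 → ‖∑' n, c n * w ^ n‖ ≤ C * ‖∑' n, b n * w ^ n‖)
    (N : ℕ) : ∑ n ∈ Finset.range N, ‖c n‖ ^ 2 ≤ C ^ 2 * ∑' n, ‖b n‖ ^ 2 := by
  have key : ∀ {d : ℕ → ℂ}, (Summable fun n => ‖d n‖) → ∀ x : AddCircle (1 : ℝ),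
      (∑' n, d n • fourier (T := 1) n) x = ∑' n, d n * (toCircle x : ℂ) ^ n := by
    intro d hd x
    have hs : Summable fun n : ℕ => d n • fourier (T := 1) n :=
      Summable.of_norm (by simpa [norm_smul, fourier_norm] using hd)
    rw [← ContinuousMap.tsum_apply hs]
    refine tsum_congr fun n => ?_
    simp [fourier_apply, AddCircle.toCircle_nsmul]
  have hB := norm_sq_toLp_tsum hb
  have hC := norm_sq_toLp_tsum hc
  rw [hB.tsum_eq]
  refine (hC.summable.sum_le_tsum _ (fun n _ => by positivity)).trans ?_
  rw [hC.tsum_eq, ← mul_pow]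
  refine pow_le_pow_left₀ (norm_nonneg _) ?_ 2
  refine Lp.norm_le_mul_norm_of_ae_le_mul ?_
  filter_upwards [ContinuousMap.coeFn_toLp (E := ℂ) (p := 2) (𝕜 := ℂ) (haarAddCircle (T := 1))
    (∑' n, b n • fourier (T := 1) n), ContinuousMap.coeFn_toLp (E := ℂ) (p := 2) (𝕜 := ℂ)
    (haarAddCircle (T := 1)) (∑' n, c n • fourier (T := 1) n)] with x hx1 hx2
  rw [hx1, hx2, key hb, key hc]
  exact h _ (Circle.norm_coe _)

theorem exists_mul {φ : ℂ → ℂ} (hφ : DifferentiableOn ℂ φ (ball 0 1)) {C : ℝ}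
    (hC : ∀ z ∈ ball (0 : ℂ) 1, ‖φ z‖ ≤ C) (f : HardySpace) :
    ∃ g : HardySpace, (∀ z : 𝔻, g z = φ z * f z) ∧ ‖g‖ ≤ C * ‖f‖ := by
  have hC0 : 0 ≤ C := (norm_nonneg _).trans (hC 0 (by simp))
  set a := coeff f with ha
  have hF := (hasFPowerSeriesOnBall (norm_apply_le a)).differentiableOn
  have hball : eball (0 : ℂ) 1 = ball 0 1 := by
    rw [← ENNReal.ofReal_one, eball_ofReal]
  rw [hball] at hF
  let G : ℂ → ℂ := fun z => φ z * ∑' n, a n * z ^ n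
  have hG : DifferentiableOn ℂ G (ball 0 1) := hφ.mul hF
  obtain ⟨c, hc⟩ : ∃ c : ℕ → ℂ, ∀ z ∈ ball (0 : ℂ) 1, HasSum (fun n => c n * z ^ n) (G z) := by
    refine ⟨fun n => (n.factorial : ℂ)⁻¹ * iteratedDeriv n G 0, fun z hz => ?_⟩
    have h := Complex.hasSum_taylorSeries_on_ball (f := G) (c := 0) (r := 1)
      hG hz
    refine (h.congr_fun fun n => ?_ :)
    simp only [sub_zero, smul_eq_mul]
    ring
  have hsum : ∀ {d : ℕ → ℂ}, (∀ z ∈ ball (0 : ℂ) 1, Summable fun n => d n * z ^ n) →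
      ∀ r ∈ Ioo (0 : ℝ) 1, Summable fun n => ‖d n * (r : ℂ) ^ n‖ := by
    intro d hd r hr
    exact (hd r (by simp [abs_of_pos hr.1, hr.2])).norm
  have hpart : ∀ N, ∑ n ∈ Finset.range N, ‖c n‖ ^ 2 ≤ C ^ 2 * ‖a‖ ^ 2 := by
    intro N
    have hr : ∀ r ∈ Ioo (0 : ℝ) 1,
        ∑ n ∈ Finset.range N, ‖c n * (r : ℂ) ^ n‖ ^ 2 ≤ C ^ 2 * ‖a‖ ^ 2 := by
      intro r hr
      have hsa := hsum (d := fun n => a n)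
        (fun z hz => (hasSum_pow a (UnitDisc.mk z (by simpa using hz))).summable) r hr
      refine (tsum_sq_le (C := C) hsa (hsum (fun z hz => (hc z hz).summable) r hr) ?_ N).trans ?_
      · intro w hw
        have hrw : (r : ℂ) * w ∈ ball (0 : ℂ) 1 := by simp [hw, abs_of_pos hr.1, hr.2]
        have h1 : ∑' n, c n * (r : ℂ) ^ n * w ^ n = G (r * w) := by
          rw [← (hc _ hrw).tsum_eq]
          exact tsum_congr fun n => by ring
        have h2 : ∑' n, a n * (r : ℂ) ^ n * w ^ n = ∑' n, a n * (r * w : ℂ) ^ n :=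
          tsum_congr fun n => by ring
        rw [h1, h2, norm_mul]
        exact mul_le_mul_of_nonneg_right (hC _ hrw) (norm_nonneg _)
      · refine mul_le_mul_of_nonneg_left ?_ (by positivity)
        rw [norm_sq_eq]
        have hle : ∀ n, ‖a n * (r : ℂ) ^ n‖ ^ 2 ≤ ‖a n‖ ^ 2 := by
          intro n
          refine pow_le_pow_left₀ (norm_nonneg _) ?_ 2
          rw [norm_mul, norm_pow]
          refine mul_le_of_le_one_right (norm_nonneg _) (pow_le_one₀ (norm_nonneg _) ?_)
          simp [abs_of_pos hr.1, hr.2.le]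
        exact Summable.tsum_le_tsum hle
          (Summable.of_nonneg_of_le (fun n => by positivity) hle (summable_sq a)) (summable_sq a)
    have ht : Filter.Tendsto (fun r : ℝ => ∑ n ∈ Finset.range N, ‖c n * (r : ℂ) ^ n‖ ^ 2)
        (nhdsWithin 1 (Iio 1)) (nhds (∑ n ∈ Finset.range N, ‖c n * ((1 : ℝ) : ℂ) ^ n‖ ^ 2)) := by
      refine Filter.Tendsto.mono_left (Continuous.tendsto ?_ 1) nhdsWithin_le_nhds
      fun_prop
    have := le_of_tendsto ht (Filter.mem_of_superset (Ioo_mem_nhdsLT (zero_lt_one' ℝ)) hr)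
    simpa using this
  have hsc : Summable fun n => ‖c n‖ ^ 2 :=
    summable_of_sum_range_le (fun n => by positivity) hpart
  let c' : ℓ²(ℕ, ℂ) := ⟨c, memℓp_gen (by simpa using hsc)⟩
  have hcoeff : coeff (ofCoeff c') = c' :=
    (LinearEquiv.ofBijective ofCoeff ofCoeff_bijective).symm_apply_apply c'
  refine ⟨ofCoeff c', fun z => ?_, ?_⟩
  · have hz : (z : ℂ) ∈ ball (0 : ℂ) 1 := by simpa using z.norm_lt_one
    rw [ofCoeff_apply, ← (hasSum_coeff f z).tsum_eq]
    exact (hc z hz).tsum_eq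
  · rw [norm_def, norm_def, hcoeff, ← ha]
    refine le_of_sq_le_sq ?_ (by positivity)
    rw [norm_sq_eq, mul_pow]
    exact hsc.tsum_le_of_sum_range_le hpart

end HardySpace

/-- For `φ` bounded and analytic on the disc and `f ∈ H²`, the pointwise product `φ f`
belongs to `H²`. -/
theorem BoundedAnalytic.mul_mem {φ : ℂ → ℂ} (hφ : BoundedAnalytic φ) (f : HardySpace) :
    (fun z : 𝔻 => φ z * f z) ∈ hardySubmodule := by
  obtain ⟨C, hC⟩ := hφ.bounded
  obtain ⟨g, hg, -⟩ := HardySpace.exists_mul hφ.differentiableOn hC f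
  exact (funext hg : (g : 𝔻 → ℂ) = _) ▸ g.2

/-- The analytic Toeplitz operator `T_φ f = φ f` on `H²`. -/
def toeplitz (φ : ℂ → ℂ) (hφ : BoundedAnalytic φ) : HardySpace →L[ℂ] HardySpace :=
  LinearMap.mkContinuousOfExistsBound
    { toFun := fun f => (⟨fun z => φ z * f z, hφ.mul_mem f⟩ : hardySubmodule)
      map_add' := fun f g => HardySpace.ext fun z => mul_add (φ z) (f z) (g z)
      map_smul' := fun c f => HardySpace.ext fun z => mul_left_comm (φ z) c (f z) }
    (by
      obtain ⟨C, hC⟩ := hφ.bounded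
      refine ⟨C, fun f => ?_⟩
      obtain ⟨g, hg, hn⟩ := HardySpace.exists_mul hφ.differentiableOn hC f
      have h : g = (⟨fun z => φ z * f z, hφ.mul_mem f⟩ : hardySubmodule) :=
        HardySpace.ext fun z => hg z
      rw [h] at hn
      exact hn)

theorem toeplitz_apply (φ : ℂ → ℂ) (hφ : BoundedAnalytic φ) (f : HardySpace) (z : 𝔻) :
    toeplitz φ hφ f z = φ z * f z := rfl

/-- `φ` singly covers `W`: it maps some subset `V` of the open unit disc injectively onto `W`, and
the points of `V` are the only points of the disc that `φ` takes into `W`. -/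
def SinglyCovers (φ : ℂ → ℂ) (W : Set ℂ) : Prop :=
  ∃ V ⊆ ball (0 : ℂ) 1, InjOn φ V ∧ φ '' V = W ∧ ball (0 : ℂ) 1 ∩ φ ⁻¹' W = V

end

/-!
Write `z` for the coordinate function and let `X` commute with `T_φ`. On the singly covered set,
`φ - φ(a)` is bounded below by a multiple of `z - a` over the whole disc, as soon as `φ'(a) ≠ 0`
(`SinglyCovers.exists_mul_norm_sub_le`): near `a` this is the derivative, and away from `a` the open
mapping theorem together with single covering keeps `φ` at a positive distance from `φ(a)`. Hence
`(z - a) / (φ - φ(a))` is a bounded analytic function `k`, and every `(z - a) v` with `v ∈ H²` is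
`(φ - φ(a)) (k v)`. Since `X` commutes with `T_φ`, the function `X ((z - a) v)` is
`(φ - φ(a)) X (k v)` and so vanishes at `a`; that is, `X (z v)` and `z (X v)` agree at `a`.
The points `a` in question fill a nonempty open set, so `X (z v) = z (X v)` by the identity theorem
(`commute_toeplitz_id_of_singlyCovers`).

An operator commuting with `T_z` acts on polynomials, hence by density on `H²`, as multiplication by
`h = X 1`; this `h` is bounded by `‖X‖`, because `|h(z)| ‖e_z‖ ≤ ‖X‖ ‖e_z‖` for the evaluation
functional `e_z ≠ 0` (`exists_eq_toeplitz_of_commute_id`). Analytic Toeplitz operators commute with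
each other, which gives the equality of the two commutants.
-/

open Complex Metric Set
open scoped Complex.UnitDisc lp

namespace HardySpace

theorem exists_differentiableOn (f : HardySpace) :
    ∃ F : ℂ → ℂ, DifferentiableOn ℂ F (ball 0 1) ∧ ∀ z : 𝔻, f z = F z := by
  have hF := (hasFPowerSeriesOnBall (norm_apply_le (coeff f))).differentiableOn
  rw [← ENNReal.ofReal_one, eball_ofReal] at hF
  exact ⟨_, hF, fun z => (hasSum_coeff f z).tsum_eq.symm⟩

theorem norm_apply_le_mul (f : HardySpace) (z : 𝔻) : ‖f z‖ ≤ (1 - ‖(z : ℂ)‖)⁻¹ * ‖f‖ := by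
  have hg := (hasSum_geometric_of_lt_one (norm_nonneg (z : ℂ)) z.norm_lt_one).mul_right ‖f‖
  rw [← (hasSum_coeff f z).tsum_eq]
  refine tsum_of_norm_bounded hg fun n => ?_
  rw [norm_mul, norm_pow, mul_comm, norm_def]
  exact mul_le_mul_of_nonneg_left (norm_apply_le _ n) (by positivity)

/-- Evaluation at a point of the disc, as a bounded functional on `H²`. -/
noncomputable def eval (z : 𝔻) : HardySpace →L[ℂ] ℂ :=
  LinearMap.mkContinuous
    { toFun := fun f => f z
      map_add' := fun _ _ => rfl
      map_smul' := fun _ _ => rfl } (1 - ‖(z : ℂ)‖)⁻¹ fun f => norm_apply_le_mul f z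

@[simp] theorem eval_apply (z : 𝔻) (f : HardySpace) : eval z f = f z := rfl

/-- The function `z ↦ zⁿ` as an element of `H²`. -/
noncomputable def monomial (n : ℕ) : HardySpace := ofCoeff (lp.single 2 n 1)

@[simp] theorem monomial_apply (n : ℕ) (z : 𝔻) : monomial n z = (z : ℂ) ^ n := by
  rw [monomial, ofCoeff_apply, tsum_eq_single n]
  · simp
  · intro m hm
    simp [Pi.single_eq_of_ne hm]

theorem toeplitz_id_monomial (n : ℕ) :
    toeplitz (fun z => z) boundedAnalytic_id (monomial n) = monomial (n + 1) :=
  ext fun z => by rw [toeplitz_apply, monomial_apply, monomial_apply, pow_succ']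

theorem hasSum_monomial (f : HardySpace) : HasSum (fun n => coeff f n • monomial n) f := by
  have hi : Topology.IsInducing coeff := isometry_coeff.isUniformInducing.isInducing
  rw [← hi.hasSum_iff (g := coeff)]
  refine (lp.hasSum_single (p := 2) (by norm_num) (coeff f)).congr_fun fun n => ?_
  have h : coeff (monomial n) = lp.single 2 n 1 :=
    (LinearEquiv.ofBijective ofCoeff ofCoeff_bijective).symm_apply_apply _
  rw [Function.comp_apply, map_smul, h, ← lp.single_smul, smul_eq_mul, mul_one]

theorem toeplitz_comm {φ ψ : ℂ → ℂ} (hφ : BoundedAnalytic φ) (hψ : BoundedAnalytic ψ) :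
    toeplitz φ hφ * toeplitz ψ hψ = toeplitz ψ hψ * toeplitz φ hφ :=
  ContinuousLinearMap.ext fun f => ext fun z => by
    simp only [mul_apply_eq_comp, toeplitz_apply]
    ring

/-- An operator commuting with the shift is multiplication by the image of `1`. -/
theorem apply_eq_mul_of_commute_id {X : HardySpace →L[ℂ] HardySpace}
    (hX : ∀ f, X (toeplitz (fun z => z) boundedAnalytic_id f) =
      toeplitz (fun z => z) boundedAnalytic_id (X f)) (f : HardySpace) (z : 𝔻) :
    X f z = X (monomial 0) z * f z := by
  have hmon : ∀ n, X (monomial n) z = X (monomial 0) z * (z : ℂ) ^ n := by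
    intro n
    induction n with
    | zero => simp
    | succ n ih => rw [← toeplitz_id_monomial, hX, toeplitz_apply, ih]; ring
  have h1 := (hasSum_monomial f).mapL ((eval z).comp X)
  refine h1.unique (((hasSum_coeff f z).mul_left (X (monomial 0) z)).congr_fun fun n => ?_)
  rw [ContinuousLinearMap.comp_apply, map_smul, map_smul, eval_apply, hmon, smul_eq_mul]
  ring

/-- The symbol is bounded because each of its values is an eigenvalue of `u ↦ u ∘ X` on the dual
space, with the evaluation functional as eigenvector. -/
theorem exists_eq_toeplitz_of_commute_id {X : HardySpace →L[ℂ] HardySpace}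
    (hX : ∀ f, X (toeplitz (fun z => z) boundedAnalytic_id f) =
      toeplitz (fun z => z) boundedAnalytic_id (X f)) :
    ∃ (h : ℂ → ℂ) (hh : BoundedAnalytic h), X = toeplitz h hh := by
  obtain ⟨F, hF, hXF⟩ := exists_differentiableOn (X (monomial 0))
  have hmul : ∀ (f : HardySpace) (z : 𝔻), X f z = F z * f z := fun f z => by
    rw [apply_eq_mul_of_commute_id hX, hXF]
  refine ⟨F, ⟨hF, ‖X‖, fun w hw => ?_⟩, ContinuousLinearMap.ext fun f => ext fun z => ?_⟩
  · let z : 𝔻 := UnitDisc.mk w (by simpa using hw)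
    rcases eq_or_ne (F w) 0 with h0 | h0
    · rw [h0, norm_zero]
      exact norm_nonneg X
    have hpos : 0 < ‖eval z‖ := by
      have h1 := (eval z).le_opNorm (monomial 0)
      rw [eval_apply, monomial_apply, pow_zero, norm_one] at h1
      exact pos_of_mul_pos_left (one_pos.trans_le h1) (norm_nonneg _)
    -- Composition with `X` multiplies the nonzero functional `eval z` by `F w`.
    have hle : ‖eval z‖ ≤ ‖F w‖⁻¹ * (‖eval z‖ * ‖X‖) := by
      refine (eval z).opNorm_le_bound (by positivity) fun f => ?_
      have h1 := (eval z).le_opNorm_of_le (X.le_opNorm f)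
      rw [eval_apply, hmul, norm_mul] at h1
      rw [mul_assoc, mul_assoc, eval_apply]
      exact (le_inv_mul_iff₀ (norm_pos_iff.2 h0)).2 h1
    rw [le_inv_mul_iff₀ (norm_pos_iff.2 h0), mul_comm] at hle
    exact le_of_mul_le_mul_left hle hpos
  · rw [hmul, toeplitz_apply]

end HardySpace

/-- Near `a` the bound comes from the nonzero derivative. By the open mapping theorem a small disc
around `φ(a)` is covered by points near `a`, so by single covering `φ` maps all other points of the
disc outside of it. -/
theorem SinglyCovers.exists_mul_norm_sub_le {φ : ℂ → ℂ} (hφ : DifferentiableOn ℂ φ (ball 0 1))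
    {W : Set ℂ} (hWo : IsOpen W) (hW : SinglyCovers φ W) {a : ℂ} (ha : a ∈ ball (0 : ℂ) 1)
    (haW : φ a ∈ W) (hd : deriv φ a ≠ 0) :
    ∃ c > 0, ∀ z ∈ ball (0 : ℂ) 1, c * ‖z - a‖ ≤ ‖φ z - φ a‖ := by
  obtain ⟨V, -, hinj, -, hpre⟩ := hW
  have hstrict : HasStrictDerivAt φ (deriv φ a) a :=
    (hφ.analyticAt (isOpen_ball.mem_nhds ha)).hasStrictDerivAt
  set c₁ := ‖deriv φ a‖ / 2 with hc₁
  have hc₁0 : 0 < c₁ := half_pos (norm_pos_iff.2 hd)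
  have hnear : ∀ᶠ z in nhds a, c₁ * ‖z - a‖ ≤ ‖φ z - φ a‖ := by
    filter_upwards [(hasDerivAt_iff_isLittleO.1 hstrict.hasDerivAt).def hc₁0] with z hz
    have h := norm_sub_norm_le ((z - a) • deriv φ a) (φ z - φ a)
    rw [norm_sub_rev ((z - a) • _), norm_smul] at h
    have h2 : ‖z - a‖ * ‖deriv φ a‖ = c₁ * ‖z - a‖ + c₁ * ‖z - a‖ := by rw [hc₁]; ring
    linarith
  have hN : {z | c₁ * ‖z - a‖ ≤ ‖φ z - φ a‖} ∩ ball 0 1 ∈ nhds a :=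
    Filter.inter_mem hnear (isOpen_ball.mem_nhds ha)
  have himage := Filter.image_mem_map (m := φ) hN
  rw [hstrict.map_nhds_eq hd] at himage
  obtain ⟨δ, hδ, hsub⟩ := Metric.mem_nhds_iff.1 (Filter.inter_mem himage (hWo.mem_nhds haW))
  refine ⟨min c₁ (δ / 2), lt_min hc₁0 (half_pos hδ), fun z hz => ?_⟩
  by_cases hzδ : φ z ∈ ball (φ a) δ
  -- Some point `b` near `a` has the value `φ z`, and single covering forces `b = z`.
  · obtain ⟨⟨b, ⟨hb, hb1⟩, hbz⟩, hzW⟩ := hsub hzδ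
    have hbV : b ∈ V := hpre ▸ ⟨hb1, show φ b ∈ W from hbz ▸ hzW⟩
    have hzV : z ∈ V := hpre ▸ ⟨hz, hzW⟩
    rw [hinj hbV hzV hbz] at hb
    exact (mul_le_mul_of_nonneg_right (min_le_left _ _) (norm_nonneg _)).trans hb
  · rw [mem_ball, not_lt, dist_eq_norm] at hzδ
    have h2 : ‖z - a‖ ≤ 2 := by
      have := norm_sub_le z a
      rw [mem_ball_zero_iff] at hz ha
      linarith
    calc min c₁ (δ / 2) * ‖z - a‖ ≤ δ / 2 * 2 := by
          gcongr
          exact min_le_right _ _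
      _ ≤ ‖φ z - φ a‖ := by linarith

/-- If `φ - φ(a)` is bounded below by a multiple of `z - a`, then `z - a` is divisible by `φ - φ(a)`
in the algebra of bounded analytic functions. -/
theorem exists_boundedAnalytic_sub_mul_eq {φ : ℂ → ℂ} (hφ : DifferentiableOn ℂ φ (ball 0 1))
    {a : ℂ} (ha : a ∈ ball (0 : ℂ) 1) (hd : deriv φ a ≠ 0) {c : ℝ} (hc : 0 < c)
    (h : ∀ z ∈ ball (0 : ℂ) 1, c * ‖z - a‖ ≤ ‖φ z - φ a‖) :
    ∃ k : ℂ → ℂ, BoundedAnalytic k ∧ ∀ z ∈ ball (0 : ℂ) 1, (φ z - φ a) * k z = z - a := by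
  have hdiff : DifferentiableOn ℂ (dslope φ a) (ball 0 1) :=
    (Complex.differentiableOn_dslope (isOpen_ball.mem_nhds ha)).2 hφ
  have hsmul : ∀ z, (z - a) * dslope φ a z = φ z - φ a := fun z => sub_smul_dslope φ a z
  have hlow : ∀ z ∈ ball (0 : ℂ) 1, z ≠ a → c ≤ ‖dslope φ a z‖ := by
    intro z hz hza
    have h1 := h z hz
    rw [← hsmul, norm_mul, mul_comm] at h1
    exact le_of_mul_le_mul_left h1 (norm_pos_iff.2 (sub_ne_zero.2 hza))
  have hne : ∀ z ∈ ball (0 : ℂ) 1, dslope φ a z ≠ 0 := by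
    intro z hz
    rcases eq_or_ne z a with rfl | hza
    · rwa [dslope_same]
    · exact norm_pos_iff.1 (hc.trans_le (hlow z hz hza))
  refine ⟨fun z => (dslope φ a z)⁻¹, ⟨hdiff.inv hne, max c⁻¹ ‖deriv φ a‖⁻¹, fun z hz => ?_⟩,
    fun z hz => ?_⟩
  · rw [norm_inv]
    rcases eq_or_ne z a with rfl | hza
    · rw [dslope_same]
      exact le_max_right _ _
    · exact (inv_anti₀ hc (hlow z hz hza)).trans (le_max_left _ _)
  · rw [← hsmul, mul_assoc, mul_inv_cancel₀ (hne z hz), mul_one]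

/-- An operator commuting with `T_φ` maps multiples of `φ - φ(a)`, in particular multiples of
`z - a`, to functions vanishing at `a`. -/
theorem apply_toeplitz_id_apply_of_sub_mul_eq {φ : ℂ → ℂ} (hφ : BoundedAnalytic φ)
    {X : HardySpace →L[ℂ] HardySpace}
    (hX : ∀ f, X (toeplitz φ hφ f) = toeplitz φ hφ (X f)) {k : ℂ → ℂ} (hk : BoundedAnalytic k)
    (a : 𝔻) (h : ∀ z ∈ ball (0 : ℂ) 1, (φ z - φ a) * k z = z - a) (v : HardySpace) :
    X (toeplitz (fun z => z) boundedAnalytic_id v) a =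
      toeplitz (fun z => z) boundedAnalytic_id (X v) a := by
  set u := toeplitz k hk v
  have hv : toeplitz (fun z => z) boundedAnalytic_id v =
      (a : ℂ) • v + (toeplitz φ hφ u + (-φ a) • u) := HardySpace.ext fun z => by
    have hz := h z (by simpa using z.norm_lt_one)
    simp only [HardySpace.add_apply, HardySpace.smul_apply, toeplitz_apply, u]
    linear_combination (-v z) * hz
  rw [hv]
  simp only [map_add, map_smul, hX, HardySpace.add_apply, HardySpace.smul_apply, toeplitz_apply]
  ring

/-- Points of the singly covered part of the disc at which `φ' ≠ 0` form a nonempty open set: an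
injective function on an open set has a derivative that is not identically zero. -/
theorem SinglyCovers.exists_eventually_deriv_ne_zero {φ : ℂ → ℂ}
    (hφ : DifferentiableOn ℂ φ (ball 0 1)) {W : Set ℂ} (hWo : IsOpen W) (hWne : W.Nonempty)
    (hW : SinglyCovers φ W) :
    ∃ a ∈ ball (0 : ℂ) 1, ∀ᶠ z in nhds a, z ∈ ball (0 : ℂ) 1 ∧ φ z ∈ W ∧ deriv φ z ≠ 0 := by
  obtain ⟨V, hV1, hinj, himage, hpre⟩ := hW
  have hVo : IsOpen V := hpre ▸ hφ.continuousOn.isOpen_inter_preimage isOpen_ball hWo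
  obtain ⟨b, hb⟩ : V.Nonempty := by
    rw [← himage] at hWne
    exact hWne.of_image
  have hex : ∃ a ∈ V, deriv φ a ≠ 0 := by
    by_contra! hzero
    obtain ⟨ε, hε, hsub⟩ := Metric.isOpen_iff.1 hVo b hb
    have hconst : ∀ z ∈ ball b ε, φ z = φ b := fun z hz =>
      isOpen_ball.is_const_of_deriv_eq_zero (convex_ball b ε).isPreconnected
        (hφ.mono (hsub.trans hV1)) (fun w hw => hzero w (hsub hw)) hz (mem_ball_self hε)
    have hmem : b + (ε / 2 : ℝ) ∈ ball b ε := by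
      simp [abs_of_pos hε, hε]
    have heq := hinj (hsub hmem) hb (hconst _ hmem)
    simp [hε.ne'] at heq
  obtain ⟨a, ha, hda⟩ := hex
  refine ⟨a, hV1 ha, ?_⟩
  have hcont : ContinuousAt (deriv φ) a :=
    (hφ.analyticAt (isOpen_ball.mem_nhds (hV1 ha))).deriv.continuousAt
  filter_upwards [hVo.mem_nhds ha, hcont.eventually_ne hda] with z hz hdz
  exact ⟨hV1 hz, himage ▸ mem_image_of_mem φ hz, hdz⟩

theorem commute_toeplitz_id_of_singlyCovers {φ : ℂ → ℂ} (hφ : BoundedAnalytic φ) {W : Set ℂ}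
    (hWo : IsOpen W) (hWne : W.Nonempty) (hW : SinglyCovers φ W)
    {X : HardySpace →L[ℂ] HardySpace} (hX : ∀ f, X (toeplitz φ hφ f) = toeplitz φ hφ (X f))
    (v : HardySpace) :
    X (toeplitz (fun z => z) boundedAnalytic_id v) =
      toeplitz (fun z => z) boundedAnalytic_id (X v) := by
  obtain ⟨F, hF, hXF⟩ := HardySpace.exists_differentiableOn
    (X (toeplitz (fun z => z) boundedAnalytic_id v))
  obtain ⟨G, hG, hXG⟩ := HardySpace.exists_differentiableOn
    (toeplitz (fun z => z) boundedAnalytic_id (X v))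
  obtain ⟨a, ha, hev⟩ :=
    hW.exists_eventually_deriv_ne_zero hφ.differentiableOn hWo hWne
  have hFG : F =ᶠ[nhds a] G := by
    filter_upwards [hev] with z hz
    obtain ⟨hz1, hzW, hdz⟩ := hz
    obtain ⟨c, hc, hlow⟩ := hW.exists_mul_norm_sub_le hφ.differentiableOn hWo hz1 hzW hdz
    obtain ⟨k, hk, hkz⟩ :=
      exists_boundedAnalytic_sub_mul_eq hφ.differentiableOn hz1 hdz hc hlow
    let z' : 𝔻 := UnitDisc.mk z (by simpa using hz1)
    have h := apply_toeplitz_id_apply_of_sub_mul_eq hφ hX hk z' hkz v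
    rwa [hXF, hXG] at h
  have heqOn := (hF.analyticOnNhd isOpen_ball).eqOn_of_preconnected_of_eventuallyEq
    (hG.analyticOnNhd isOpen_ball) (convex_ball 0 1).isPreconnected ha hFG
  refine HardySpace.ext fun z => ?_
  rw [hXF, hXG]
  exact heqOn (by simpa using z.norm_lt_one)

theorem mainTheorem11 (φ : ℂ → ℂ) (hφ : BoundedAnalytic φ) (W : Set ℂ) (hWo : IsOpen W)
    (hWne : W.Nonempty) (hWsub : W ⊆ φ '' Metric.ball (0 : ℂ) 1) (hW : SinglyCovers φ W) :
    Set.centralizer {toeplitz φ hφ} = Set.centralizer {toeplitz (fun z => z) boundedAnalytic_id} ∧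
      ∀ X ∈ Set.centralizer {toeplitz φ hφ},
        ∃ (h : ℂ → ℂ) (hh : BoundedAnalytic h), X = toeplitz h hh := by
  have hmem : ∀ {ψ : ℂ → ℂ} (hψ : BoundedAnalytic ψ) (X : HardySpace →L[ℂ] HardySpace),
      X ∈ Set.centralizer {toeplitz ψ hψ} ↔
        ∀ f, X (toeplitz ψ hψ f) = toeplitz ψ hψ (X f) := by
    intro ψ hψ X
    rw [Set.mem_centralizer_iff]
    refine ⟨fun h f => (DFunLike.congr_fun (h _ rfl) f).symm, ?_⟩
    rintro h _ rfl
    exact ContinuousLinearMap.ext fun f => (h f).symm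
  have hsub : ∀ X ∈ Set.centralizer {toeplitz φ hφ},
      X ∈ Set.centralizer {toeplitz (fun z => z) boundedAnalytic_id} := fun X hX =>
    (hmem _ X).2 (commute_toeplitz_id_of_singlyCovers hφ hWo hWne hW ((hmem _ X).1 hX))
  refine ⟨Set.Subset.antisymm hsub fun X hX => ?_, fun X hX =>
    HardySpace.exists_eq_toeplitz_of_commute_id ((hmem _ X).1 (hsub X hX))⟩
  obtain ⟨h, hh, rfl⟩ := HardySpace.exists_eq_toeplitz_of_commute_id ((hmem _ X).1 hX)
  rw [Set.mem_centralizer_iff]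
  rintro _ rfl
  exact HardySpace.toeplitz_comm hφ hh
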